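/- Let $K$ be a field of arbitrary characteristic, let $x_1,\dots,x_n$ be indeterminates, and let $f_1,\dots,f_n\in K[x_1,\dots,x_n]$ be polynomials whose Jacobian determinant $\det\left(\frac{\partial f_i}{\partial x_j}\right)_{i,j}$ is a unit of $K[x_1,\dots,x_n]$ (i.e. lies in $K[x_1,\dots,x_n]^\times=K^\times$). An $n$-variate higher derivation on a commutative ring $R$ is a ring homomorphism $\theta:R\to R[[T_1,\dots,T_n]]$ with $\theta(r)|_{T=0}=r$ for all $r\in R$. Writing $\theta(r)=\sum_{\alpha\in\mathbb{N}^n}\theta^{(\alpha)}(r)T^\alpha$, it is called iterative if $\theta^{(\alpha)}\circ\theta^{(\beta)}=\binom{\alpha+\beta}{\alpha}\theta^{(\alpha+\beta)}$ for all $\alpha,\beta\in\mathbb{N}^n$, where $\binom{\alpha+\beta}{\alpha}=\prod_i\binom{\alpha_i+\beta_i}{\alpha_i}$. Then $f_1,\dots,f_n$ are algebraically independent over $K$. Consequently there is a well-defined higher derivation $\theta_f$ on $K[f_1,\dots,f_n]$, namely the homomorphism of $K$-algebras $\theta_f:K[f_1,\dots,f_n]\to K[f_1,\dots,f_n][[T_1,\dots,T_n]]$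 with $\theta_f(f_i)=f_i+T_i$ for $i=1,\dots,n$. There is exactly one $n$-variate higher derivation on $K[x_1,\dots,x_n]$ whose restriction to $K[f_1,\dots,f_n]$ is $\theta_f$, and this extension is iterative. -/

import Mathlib

/-- A `d`-variate higher derivation on a commutative ring `R`: a ring homomorphism
`θ : R → R[[T₁, …, T_d]]` such that `θ(r)` evaluated at `T = 0` is `r`, for all `r`. -/
@[ext]
structure HigherDerivation (d : ℕ) (R : Type*) [CommRing R] where
  toRingHom : R →+* MvPowerSeries (Fin d) R
  constantCoeff_toRingHom : ∀ r : R, MvPowerSeries.constantCoeff (toRingHom r) = r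

namespace HigherDerivation

variable {d : ℕ} {R : Type*} [CommRing R]

/-- The map `θ^(α) : R → R`, sending `r` to the coefficient of `T^α` in `θ(r)`. -/
noncomputable def component (θ : HigherDerivation d R) (α : Fin d →₀ ℕ) (r : R) : R :=
  MvPowerSeries.coeff α (θ.toRingHom r)

/-- `θ` is iterative if `θ^(α) ∘ θ^(β) = (α + β choose α) θ^(α + β)` for all multi-indices,
the multi-index binomial coefficient being the product of those of the entries. -/
def IsIterative (θ : HigherDerivation d R) : Prop :=
  ∀ (α β : Fin d →₀ ℕ) (r : R),
    θ.component α (θ.component β r) =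
      ((∏ i, ((α + β) i).choose (α i) : ℕ) : R) * θ.component (α + β) r

/-- `Θ` on `S` extends `θ` on `R`, for a ring extension `S` of `R`: the restriction of `Θ` to `R`
is `θ`, as maps into `S[[T]]`. -/
def Extends {S : Type*} [CommRing S] [Algebra R S]
    (Θ : HigherDerivation d S) (θ : HigherDerivation d R) : Prop :=
  ∀ r : R, Θ.toRingHom (algebraMap R S r) =
    MvPowerSeries.map (algebraMap R S) (θ.toRingHom r)

open MvPolynomial in
/-- The higher derivation `θ_t` with respect to `t = (t₁, …, t_d)` on `K[t₁, …, t_d]`, where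
`t₁, …, t_d` are elements of a `K`-algebra that are algebraically independent over `K`, so that
`K[t₁, …, t_d]` is a polynomial ring in them: it is the homomorphism of `K`-algebras with
`θ_t(t_i) = t_i + T_i` for all `i`. -/
noncomputable def withRespectTo {K S : Type*} [Field K] [CommRing S] [Algebra K S]
    {t : Fin d → S} (ht : AlgebraicIndependent K t) :
    HigherDerivation d (Algebra.adjoin K (Set.range t)) where
  toRingHom :=
    ((aeval fun i : Fin d =>
        MvPowerSeries.C (⟨t i, Algebra.subset_adjoin (Set.mem_range_self i)⟩ :
          Algebra.adjoin K (Set.range t)) + MvPowerSeries.X i :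
      MvPolynomial (Fin d) K →ₐ[K]
        MvPowerSeries (Fin d) (Algebra.adjoin K (Set.range t))).comp
      ht.aevalEquiv.symm.toAlgHom).toRingHom
  constantCoeff_toRingHom := by
    intro r
    obtain ⟨p, rfl⟩ := ht.aevalEquiv.surjective r
    apply Subtype.ext
    simp only [AlgHom.toRingHom_eq_coe, RingHom.coe_coe, AlgHom.comp_apply]
    induction p using MvPolynomial.induction_on with
    | C a => simp [MvPowerSeries.algebraMap_apply]
    | add p q hp hq => simp_all
    | mul_X p i hp => simp_all

end HigherDerivation

/-- The Jacobian matrix `(∂f_i / ∂x_j)_{i,j}` of an `n`-tuple of polynomials in `n` variables. -/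
noncomputable def jacobianMatrix {n : ℕ} {K : Type*} [Field K]
    (f : Fin n → MvPolynomial (Fin n) K) : Matrix (Fin n) (Fin n) (MvPolynomial (Fin n) K) :=
  Matrix.of fun i j => MvPolynomial.pderiv j (f i)

/-! A unit Jacobian makes the `df_i` a basis of the differentials of `K[x]`, so `K[y] → K[x]`, `y_i
↦ f_i`, is formally étale. As `K[x][[T]]` is `(T)`-adically complete, `y_i ↦ f_i + T_i` extends
along this map to a unique ring homomorphism `Θ` on `K[x]` with constant term the identity.
Independence follows: `y_i ↦ f_i + T_i` is injective and factors through `y_i ↦ f_i`. Iterativity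
says that applying `Θ` twice equals `Θ` followed by `T ↦ T + U`; both homomorphisms send `f_i` to
`f_i + U_i + T_i` and have constant term `Θ` in `T`, so étaleness identifies them. -/

/-! ### Formal étaleness from a unit Jacobian -/

namespace Algebra.FormallyEtale

open KaehlerDifferential

/-- Let `S` be formally smooth over `K` and an algebra over the polynomial ring `K[y]`. If the
differentials of the images of the variables form a basis of `Ω[S⁄K]`, then `S` is formally étale
over `K[y]`. -/
theorem of_basis_kaehlerDifferential {ι K S : Type*} [CommRing K] [CommRing S] [Algebra K S]
    [Algebra (MvPolynomial ι K) S] [IsScalarTower K (MvPolynomial ι K) S] [FormallySmooth K S]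
    (b : Module.Basis ι S Ω[S⁄K])
    (hb : ∀ i, b i = D K S (algebraMap (MvPolynomial ι K) S (MvPolynomial.X i))) :
    FormallyEtale (MvPolynomial ι K) S := by
  have hbij : Function.Bijective (mapBaseChange K (MvPolynomial ι K) S) := by
    have key : mapBaseChange K (MvPolynomial ι K) S =
        (((mvPolynomialBasis K ι).baseChange S).equiv b (Equiv.refl ι)).toLinearMap := by
      refine ((mvPolynomialBasis K ι).baseChange S).ext fun i => ?_
      rw [LinearEquiv.coe_coe, Module.Basis.equiv_apply]
      simp [hb]
    rw [key]
    exact LinearEquiv.bijective _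
  constructor
  · refine subsingleton_of_forall_eq 0 fun x => ?_
    obtain ⟨y, rfl⟩ := map_surjective K (MvPolynomial ι K) S x
    obtain ⟨z, rfl⟩ := hbij.2 y
    exact (exact_mapBaseChange_map K (MvPolynomial ι K) S).apply_apply_eq_zero z
  -- Injectivity of the base change map kills the boundary of `x`, so `x` comes from `H1Cotangent`
  -- of `S` over `K`, which is zero by formal smoothness.
  · refine subsingleton_of_forall_eq 0 fun x => ?_
    have hx := (H1Cotangent.exact_δ_mapBaseChange K (MvPolynomial ι K) S).apply_apply_eq_zero x
    rw [map_eq_zero_iff _ hbij.1] at hx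
    obtain ⟨y, rfl⟩ := (H1Cotangent.exact_map_δ K (MvPolynomial ι K) S x).1 hx
    rw [Subsingleton.elim y 0, map_zero]

end Algebra.FormallyEtale

namespace RingHom.FormallyEtale

variable {R S B : Type*} [CommRing R] [CommRing S] [CommRing B]

theorem of_basis_kaehlerDifferential {ι K : Type*} [CommRing K] [Algebra K S]
    [Algebra.FormallySmooth K S] (φ : MvPolynomial ι K →ₐ[K] S) (b : Module.Basis ι S Ω[S⁄K])
    (hb : ∀ i, b i = KaehlerDifferential.D K S (φ (MvPolynomial.X i))) :
    φ.toRingHom.FormallyEtale := by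
  let _ := φ.toRingHom.toAlgebra
  have : IsScalarTower K (MvPolynomial ι K) S := .of_algebraMap_eq' φ.comp_algebraMap.symm
  exact Algebra.FormallyEtale.of_basis_kaehlerDifferential b hb

theorem exists_lift_of_isAdicComplete {φ : R →+* S} (hφ : φ.FormallyEtale) (I : Ideal B)
    [IsAdicComplete I B] (ψ : R →+* B) (g : S →+* B ⧸ I)
    (h : g.comp φ = (Ideal.Quotient.mk I).comp ψ) :
    ∃ Θ : S →+* B, Θ.comp φ = ψ ∧ (Ideal.Quotient.mk I).comp Θ = g := by
  let _ := φ.toAlgebra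
  let _ := ψ.toAlgebra
  have : Algebra.FormallyEtale R S := hφ
  obtain ⟨Θ, hΘ⟩ := Algebra.FormallySmooth.exists_mkₐ_comp_eq_of_isAdicComplete (I := I)
    ({ g with commutes' := fun r => congr($h r) } : S →ₐ[R] B ⧸ I)
  exact ⟨Θ.toRingHom, RingHom.ext fun r => Θ.commutes r, RingHom.ext fun s => congr($hΘ s)⟩

theorem ext_of_iInf_pow_ker {C : Type*} [CommRing C] {φ : R →+* S} (hφ : φ.FormallyEtale)
    (π : B →+* C) (hπ : ⨅ k : ℕ, RingHom.ker π ^ k = ⊥) {g₁ g₂ : S →+* B}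
    (h : g₁.comp φ = g₂.comp φ) (h' : π.comp g₁ = π.comp g₂) : g₁ = g₂ := by
  let _ := φ.toAlgebra
  let _ := (g₁.comp φ).toAlgebra
  have : Algebra.FormallyEtale R S := hφ
  have := Algebra.FormallyUnramified.ext_of_iInf (RingHom.ker π) hπ
    (g₁ := ({ g₁ with commutes' := fun r => rfl } : S →ₐ[R] B))
    (g₂ := ({ g₂ with commutes' := fun r => congr($h.symm r) } : S →ₐ[R] B))
    (fun x => by
      rw [Ideal.Quotient.eq, RingHom.mem_ker, map_sub, sub_eq_zero]
      exact congr($h' x))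
  exact RingHom.ext fun x => congr($this x)

end RingHom.FormallyEtale

/-- The `df_i` have the transposed Jacobian as matrix in the basis `dx_j`. -/
theorem MvPolynomial.formallyEtale_aeval_of_isUnit_det {n : ℕ} {K : Type*} [Field K]
    (f : Fin n → MvPolynomial (Fin n) K) (hJ : IsUnit (jacobianMatrix f).det) :
    (aeval f : MvPolynomial (Fin n) K →ₐ[K] MvPolynomial (Fin n) K).toRingHom.FormallyEtale := by
  let e := KaehlerDifferential.mvPolynomialBasis K (Fin n)
  let v : Fin n → Ω[MvPolynomial (Fin n) K⁄K] := fun i => KaehlerDifferential.D K _ (f i)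
  have hdet : e.det v = (jacobianMatrix f).det := by
    rw [Module.Basis.det_apply, ← Matrix.det_transpose]
    congr 1
    ext1 i j
    simp [e, v, jacobianMatrix, Module.Basis.toMatrix_apply]
  have hv := (Module.Basis.is_basis_iff_det e).2 (hdet ▸ hJ)
  refine RingHom.FormallyEtale.of_basis_kaehlerDifferential (aeval f)
    (Module.Basis.mk hv.1 hv.2.ge) fun i => ?_
  rw [Module.Basis.mk_apply, aeval_X]

/-! ### Power series: separatedness and the substitution `T ↦ T + U` -/

namespace MvPowerSeries

variable {σ R : Type*} [CommRing R]

/-- Elements of the `k`-th power have order at least `k`, and only zero has infinite order. -/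
theorem iInf_pow_ker_constantCoeff :
    ⨅ k : ℕ, RingHom.ker (constantCoeff (σ := σ) (R := R)) ^ k = ⊥ := by
  have key (k : ℕ) (a : MvPowerSeries σ R)
      (ha : a ∈ RingHom.ker (constantCoeff (σ := σ) (R := R)) ^ k) : (k : ℕ∞) ≤ a.order := by
    induction k generalizing a with
    | zero => simp
    | succ k ih =>
      rw [pow_succ] at ha
      induction ha using Submodule.mul_induction_on' with
      | mem_mul_mem r hr s hs =>
        rw [Nat.cast_add, Nat.cast_one]
        exact (add_le_add (ih r hr) (one_le_order_iff_constCoeff_eq_zero.2 hs)).trans le_order_mul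
      | add x _ y _ hx hy => exact (le_min hx hy).trans min_order_le_add
  rw [eq_bot_iff]
  intro a ha
  rw [Submodule.mem_bot, ← order_eq_top_iff, ENat.eq_top_iff_forall_ge]
  exact fun k => key k a ((Submodule.mem_iInf _).1 ha k)

theorem ringHom_eq_of_formallyEtale {A S : Type*} [CommRing A] [CommRing S] {φ : A →+* S}
    (hφ : φ.FormallyEtale) {g₁ g₂ : S →+* MvPowerSeries σ R} (h : g₁.comp φ = g₂.comp φ)
    (h' : constantCoeff.comp g₁ = constantCoeff.comp g₂) : g₁ = g₂ :=
  hφ.ext_of_iInf_pow_ker (constantCoeff (R := R)) iInf_pow_ker_constantCoeff h h'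

/-- Vandermonde's identity in each variable, multiplied out; it makes `addVariables` multiplicative.
-/
theorem prod_choose_add [Fintype σ] [DecidableEq σ] (a b c : σ →₀ ℕ) :
    ∏ i, ((a + b) i).choose (c i) = ∑ p ∈ Finset.HasAntidiagonal.antidiagonal c,
      (∏ i, (a i).choose (p.1 i)) * ∏ i, (b i).choose (p.2 i) := by
  simp_rw [Finsupp.add_apply, Nat.add_choose_eq, Finset.prod_univ_sum, ← Finset.prod_mul_distrib]
  refine Finset.sum_nbij'
    (fun p => (Finsupp.equivFunOnFinite.symm fun i => (p i).1,
      Finsupp.equivFunOnFinite.symm fun i => (p i).2))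
    (fun p i => (p.1 i, p.2 i)) ?_ ?_ ?_ ?_ ?_
  · intro p hp
    rw [Finset.HasAntidiagonal.mem_antidiagonal]
    ext i
    simpa using Fintype.mem_piFinset.1 hp i
  · intro p hp
    rw [Finset.HasAntidiagonal.mem_antidiagonal] at hp
    rw [Fintype.mem_piFinset]
    intro i
    simp [← hp]
  · intro p _
    rfl
  · intro p _
    ext <;> rfl
  · intro p _
    rfl

/-- The substitution `T ↦ T + U`, as a map from `R[[T]]` to `R[[U]][[T]]`. -/
noncomputable def addVariables (σ R : Type*) [Fintype σ] [CommRing R] :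
    MvPowerSeries σ R →+* MvPowerSeries σ (MvPowerSeries σ R) where
  -- The binomial is the coefficient of `U^α T^β` in `(T + U)^(α + β)`.
  toFun a := fun β α => ((∏ i, ((α + β) i).choose (α i) : ℕ) : R) * coeff (α + β) a
  map_zero' := by
    ext β α
    exact mul_zero _
  map_add' a b := by
    ext β α
    exact mul_add _ _ _
  map_one' := by
    classical
    ext β α
    change ((∏ i, ((α + β) i).choose (α i) : ℕ) : R) * coeff (α + β) 1 = coeff α (coeff β 1)
    rw [coeff_one, coeff_one]
    by_cases hβ : β = 0
    · subst hβ
      simp [coeff_one]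
    · simp [hβ]
  map_mul' a b := by
    classical
    ext β α
    let ψ : MvPowerSeries σ R → MvPowerSeries σ (MvPowerSeries σ R) := fun a β α =>
      ((∏ i, ((α + β) i).choose (α i) : ℕ) : R) * coeff (α + β) a
    change ((∏ i, ((α + β) i).choose (α i) : ℕ) : R) * coeff (α + β) (a * b) =
      coeff α (coeff β (ψ a * ψ b))
    rw [coeff_mul, coeff_mul, map_sum, Finset.mul_sum]
    have hl : ∀ γ ∈ Finset.HasAntidiagonal.antidiagonal (α + β),
        ((∏ i, ((α + β) i).choose (α i) : ℕ) : R) * (coeff γ.1 a * coeff γ.2 b) =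
        ∑ p ∈ Finset.HasAntidiagonal.antidiagonal α, ((∏ i, (γ.1 i).choose (p.1 i) : ℕ) : R) *
          ((∏ i, (γ.2 i).choose (p.2 i) : ℕ) : R) * (coeff γ.1 a * coeff γ.2 b) := by
      intro γ hγ
      rw [← Finset.HasAntidiagonal.mem_antidiagonal.1 hγ, prod_choose_add, Nat.cast_sum, Finset.sum_mul]
      simp_rw [Nat.cast_mul]
    rw [Finset.sum_congr rfl hl, Finset.sum_comm]
    simp_rw [coeff_mul]
    rw [Finset.sum_comm (s := Finset.HasAntidiagonal.antidiagonal β)]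
    refine Finset.sum_congr rfl fun p hp => ?_
    rw [Finset.HasAntidiagonal.mem_antidiagonal] at hp
    symm
    -- For a fixed splitting `p` of `α`, splittings `q` of `β` embed into those of `α + β`; outside
    -- the image some binomial vanishes.
    refine Finset.sum_of_injOn (fun q => (p.1 + q.1, p.2 + q.2)) ?_ ?_ ?_ ?_
    · intro q _ q' _ h
      simpa [Prod.ext_iff] using h
    · intro q hq
      simp only [Finset.mem_coe, Finset.HasAntidiagonal.mem_antidiagonal] at hq ⊢
      rw [← hp, ← hq]
      abel
    · intro γ hγ h
      rw [Finset.HasAntidiagonal.mem_antidiagonal] at hγ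
      by_cases h₁ : p.1 ≤ γ.1
      · by_cases h₂ : p.2 ≤ γ.2
        · refine absurd ⟨(γ.1 - p.1, γ.2 - p.2), ?_, ?_⟩ h
          · rw [Finset.mem_coe, Finset.HasAntidiagonal.mem_antidiagonal]
            refine add_left_cancel (a := α) ?_
            rw [← hγ, ← hp, add_add_add_comm, add_tsub_cancel_of_le h₁, add_tsub_cancel_of_le h₂]
          · simp only [add_tsub_cancel_of_le h₁, add_tsub_cancel_of_le h₂]
        · obtain ⟨i, hi⟩ := not_forall.1 h₂
          rw [Finset.prod_eq_zero (f := fun i => (γ.2 i).choose (p.2 i)) (Finset.mem_univ i)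
            (Nat.choose_eq_zero_of_lt (not_le.1 hi))]
          simp
      · obtain ⟨i, hi⟩ := not_forall.1 h₁
        rw [Finset.prod_eq_zero (f := fun i => (γ.1 i).choose (p.1 i)) (Finset.mem_univ i)
          (Nat.choose_eq_zero_of_lt (not_le.1 hi))]
        simp
    · intro q _
      change (((∏ i, ((p.1 + q.1) i).choose (p.1 i) : ℕ) : R) * coeff (p.1 + q.1) a) *
        (((∏ i, ((p.2 + q.2) i).choose (p.2 i) : ℕ) : R) * coeff (p.2 + q.2) b) = _
      ring

variable [Fintype σ]

theorem coeff_coeff_addVariables (a : MvPowerSeries σ R) (α β : σ →₀ ℕ) :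
    coeff α (coeff β (addVariables σ R a)) =
      ((∏ i, ((α + β) i).choose (α i) : ℕ) : R) * coeff (α + β) a := rfl

theorem constantCoeff_addVariables (a : MvPowerSeries σ R) :
    constantCoeff (addVariables σ R a) = a := by
  ext α
  rw [← coeff_zero_eq_constantCoeff_apply, coeff_coeff_addVariables]
  simp

theorem addVariables_C (r : R) : addVariables σ R (C r) = C (C r) := by
  classical
  ext β α
  rw [coeff_coeff_addVariables, coeff_C, coeff_C]
  by_cases hβ : β = 0
  · subst hβ
    by_cases hα : α = 0
    · simp [hα]
    · simp [hα, coeff_C]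
  · simp [hβ]

theorem addVariables_X (i : σ) : addVariables σ R (X i) = C (X i) + X i := by
  classical
  ext β α
  rw [coeff_coeff_addVariables, map_add, map_add, coeff_C, coeff_X, coeff_X]
  by_cases hβ : β = 0
  · subst hβ
    have : (0 : σ →₀ ℕ) ≠ Finsupp.single i 1 := by simp [eq_comm]
    simp [coeff_X, this]
  · rw [if_neg hβ, map_zero, zero_add]
    by_cases h : α = 0
    · subst h
      by_cases h' : β = Finsupp.single i 1 <;> simp [h']
    · have h₁ : α + β ≠ Finsupp.single i 1 := by
        intro h₂
        have := congrArg Finsupp.degree h₂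
        rw [map_add, Finsupp.degree_single] at this
        have hα := mt (Finsupp.degree_eq_zero_iff α).1 h
        have hβ' := mt (Finsupp.degree_eq_zero_iff β).1 hβ
        omega
      rw [if_neg h₁]
      by_cases h' : β = Finsupp.single i 1 <;> simp [h', coeff_one, h]

end MvPowerSeries

/-! ### Higher derivations along a formally étale map -/

namespace HigherDerivation

variable {d : ℕ}

theorem extends_withRespectTo_iff {K S : Type*} [Field K] [CommRing S] [Algebra K S]
    {t : Fin d → S} (ht : AlgebraicIndependent K t) (Θ : HigherDerivation d S) :
    Θ.Extends (withRespectTo ht) ↔ ∀ p : MvPolynomial (Fin d) K,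
      Θ.toRingHom (MvPolynomial.aeval t p) =
        MvPolynomial.aeval (fun i => MvPowerSeries.C (t i) + MvPowerSeries.X i) p := by
  unfold Extends
  refine ht.aevalEquiv.surjective.forall.trans (forall_congr' fun p => ?_)
  rw [ht.algebraMap_aevalEquiv]
  suffices h : MvPowerSeries.map (algebraMap (Algebra.adjoin K (Set.range t)) S)
      ((withRespectTo ht).toRingHom (ht.aevalEquiv p)) =
      MvPolynomial.aeval (fun i => MvPowerSeries.C (t i) + MvPowerSeries.X i) p by
    rw [h]
  simp only [withRespectTo, AlgHom.toRingHom_eq_coe, RingHom.coe_coe, AlgHom.comp_apply]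
  induction p using MvPolynomial.induction_on with
  | C a =>
    simp [MvPowerSeries.algebraMap_apply]
  | add p q hp hq => simp_all
  | mul_X p i hp => simp_all

/-- Compare coefficients of `U^α T^β`. As an equality of ring homomorphisms, iterativity can be
tested on the `t_i`. -/
theorem isIterative_iff {R : Type*} [CommRing R] (Θ : HigherDerivation d R) :
    Θ.IsIterative ↔ (MvPowerSeries.map Θ.toRingHom).comp Θ.toRingHom =
      (MvPowerSeries.addVariables (Fin d) R).comp Θ.toRingHom := by
  constructor
  · intro h
    ext r β α
    exact h α β r
  · intro h α β r
    exact congrArg (fun a => MvPowerSeries.coeff α (MvPowerSeries.coeff β a)) congr($h r)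

section FormallyEtale

variable {K S : Type*} [Field K] [CommRing S] [Algebra K S] {t : Fin d → S}

theorem exists_aeval_eq_of_formallyEtale
    (h : (MvPolynomial.aeval t : MvPolynomial (Fin d) K →ₐ[K] S).toRingHom.FormallyEtale) :
    ∃ Θ : HigherDerivation d S, ∀ p : MvPolynomial (Fin d) K,
      Θ.toRingHom (MvPolynomial.aeval t p) =
        MvPolynomial.aeval (fun i => MvPowerSeries.C (t i) + MvPowerSeries.X i) p := by
  let I : Ideal (MvPowerSeries (Fin d) S) := Ideal.span (Set.range MvPowerSeries.X)
  have hI : I ≤ RingHom.ker MvPowerSeries.constantCoeff := by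
    rw [Ideal.span_le]
    rintro _ ⟨i, rfl⟩
    exact MvPowerSeries.constantCoeff_X i
  obtain ⟨Θ, hΘ, hΘ'⟩ := h.exists_lift_of_isAdicComplete I
    (MvPolynomial.aeval (fun i => MvPowerSeries.C (t i) + MvPowerSeries.X i)).toRingHom
    ((Ideal.Quotient.mk I).comp MvPowerSeries.C) (by
      refine MvPolynomial.ringHom_ext (fun a => ?_) fun i => ?_
      · simp [MvPowerSeries.algebraMap_apply]
      · have hX : Ideal.Quotient.mk I (MvPowerSeries.X i) = 0 :=
          Ideal.Quotient.eq_zero_iff_mem.2 (Ideal.subset_span ⟨i, rfl⟩)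
        simp [hX])
  refine ⟨⟨Θ, fun s => ?_⟩, fun p => congr($hΘ p)⟩
  have hs := hI (Ideal.Quotient.eq.1 congr($hΘ' s))
  rw [RingHom.mem_ker, map_sub, sub_eq_zero] at hs
  exact hs.trans (MvPowerSeries.constantCoeff_C s)

theorem eq_of_formallyEtale {R : Type*} [CommRing R] {φ : R →+* S} (h : φ.FormallyEtale)
    {Θ Θ' : HigherDerivation d S} (h' : Θ.toRingHom.comp φ = Θ'.toRingHom.comp φ) : Θ = Θ' := by
  refine HigherDerivation.ext
    (MvPowerSeries.ringHom_eq_of_formallyEtale h h' (RingHom.ext fun s => ?_))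
  exact (Θ.constantCoeff_toRingHom s).trans (Θ'.constantCoeff_toRingHom s).symm

theorem isIterative_of_formallyEtale
    (h : (MvPolynomial.aeval t : MvPolynomial (Fin d) K →ₐ[K] S).toRingHom.FormallyEtale)
    (Θ : HigherDerivation d S) (hΘ : ∀ p : MvPolynomial (Fin d) K,
      Θ.toRingHom (MvPolynomial.aeval t p) =
        MvPolynomial.aeval (fun i => MvPowerSeries.C (t i) + MvPowerSeries.X i) p) :
    Θ.IsIterative := by
  have hC (a : K) : Θ.toRingHom (algebraMap K S a) = MvPowerSeries.C (algebraMap K S a) := by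
    simpa [MvPowerSeries.algebraMap_apply] using hΘ (MvPolynomial.C a)
  have ht (i : Fin d) : Θ.toRingHom (t i) = MvPowerSeries.C (t i) + MvPowerSeries.X i := by
    simpa using hΘ (MvPolynomial.X i)
  rw [isIterative_iff]
  refine MvPowerSeries.ringHom_eq_of_formallyEtale h ?_ ?_
  · refine MvPolynomial.ringHom_ext (fun a => ?_) fun i => ?_
    · simp [hC, MvPowerSeries.addVariables_C]
    · simp [ht, MvPowerSeries.addVariables_C, MvPowerSeries.addVariables_X, add_assoc]
  · ext1 s
    simp only [RingHom.comp_apply, MvPowerSeries.constantCoeff_addVariables,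
      MvPowerSeries.constantCoeff_map, Θ.constantCoeff_toRingHom]

end FormallyEtale

end HigherDerivation

/-- The image consists of polynomials in `T`, and evaluating at `T_i = x_i - f_i` gives a left
inverse. -/
theorem MvPolynomial.aeval_C_add_X_injective {σ K : Type*} [Field K]
    (f : σ → MvPolynomial σ K) :
    Function.Injective (aeval (fun i => MvPowerSeries.C (f i) + MvPowerSeries.X i) :
      MvPolynomial σ K →ₐ[K] MvPowerSeries σ (MvPolynomial σ K)) := by
  let s : MvPolynomial σ K →ₐ[K] MvPolynomial σ (MvPolynomial σ K) :=
    aeval fun i => C (f i) + X i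
  let r : MvPolynomial σ (MvPolynomial σ K) →ₐ[K] MvPolynomial σ K :=
    (aeval fun i => X i - f i : _ →ₐ[MvPolynomial σ K] _).restrictScalars K
  have hrs : r.comp s = AlgHom.id K _ := by
    ext1 i
    simp [r, s]
  have hs (p : MvPolynomial σ K) :
      aeval (fun i => MvPowerSeries.C (f i) + MvPowerSeries.X i) p =
        (s p : MvPowerSeries σ (MvPolynomial σ K)) := by
    induction p using MvPolynomial.induction_on with
    | C a => simp [s, MvPowerSeries.algebraMap_apply, algebraMap_apply]
    | add p q hp hq => simp_all
    | mul_X p i hp => simp_all [s]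
  intro p q hpq
  rw [hs, hs, coe_inj] at hpq
  simpa using (congr($hrs p)).symm.trans ((congrArg r hpq).trans congr($hrs q))

theorem corollary4p6 {K : Type*} [Field K] (n : ℕ) (f : Fin n → MvPolynomial (Fin n) K)
    (hJ : IsUnit (jacobianMatrix f).det) :
    ∃ hf : AlgebraicIndependent K f,
      (∃! Θ : HigherDerivation n (MvPolynomial (Fin n) K),
        Θ.Extends (HigherDerivation.withRespectTo hf)) ∧
      ∀ Θ : HigherDerivation n (MvPolynomial (Fin n) K),
        Θ.Extends (HigherDerivation.withRespectTo hf) → Θ.IsIterative := by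
  have h := MvPolynomial.formallyEtale_aeval_of_isUnit_det f hJ
  obtain ⟨Θ, hΘ⟩ := HigherDerivation.exists_aeval_eq_of_formallyEtale h
  have hf : AlgebraicIndependent K f := fun p q hpq =>
    MvPolynomial.aeval_C_add_X_injective f (by rw [← hΘ, ← hΘ, hpq])
  simp only [HigherDerivation.extends_withRespectTo_iff]
  refine ⟨hf, ⟨Θ, hΘ, fun Θ' hΘ' => ?_⟩, HigherDerivation.isIterative_of_formallyEtale h⟩
  exact HigherDerivation.eq_of_formallyEtale h (RingHom.ext fun p => (hΘ' p).trans (hΘ p).symm)
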